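/- Let $n\ge 3$ and let $S_n$ be the star graph with vertex set $\{0,1,\dots,n-1\}$ and edges $\{0,i\}$, $1\le i\le n-1$. A partial transformation $\alpha$ of $\{0,\dots,n-1\}$ is a partial strong endomorphism of $S_n$ if, for all $u,v\in\operatorname{dom}(\alpha)$, $\{u,v\}$ is an edge if and only if $\{u\alpha,v\alpha\}$ is an edge; these form a monoid $\mathrm{PsEnd}(S_n)$ under composition from left to right. Consider the following partial transformations of $\{0,\dots,n-1\}$, where points that are not mentioned are outside the domain: - $a_0$ is the transposition of $1$ and $2$, fixing all other points; - $b_0$ fixes $0$ and acts on $\{1,\dots,n-1\}$ as the cycle $1\mapsto 2\mapsto\cdots\mapsto n-1\mapsto 1$; - $e_0$ sends $2\mapsto 1$ and fixes all other points; - $f_0$ is the identity on $\{0,2,3,\dots,n-1\}$; - $d$ is the identity on $\{1,\dots,n-1\}$; - $z$ sends $0\mapsto 1$ and $i\mapsto 0$ for $1\le i\le n-1$. Let $\mathcal{PT}(\Omega_{n-1})\zeta$ be the monoid of all partial transformations $\alpha$ of $\{0,\dots,n-1\}$ that have $0$ in their domain, with $0\alpha=0$, and send no element of $\{1,\dots,n-1\}$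 to $0$. A presentation $\langle X\mid R\rangle$ is said to define a monoid $M$ on given elements of $M$ indexed by $X$ if there is an isomorphism from $X^*/{\sim_R}$ onto $M$ that maps the class of each letter to the corresponding element, where $\sim_R$ is the congruence on the free monoid $X^*$ generated by $R$. Let $R_0$ be any set of relations on the alphabet $\{a_0,b_0,e_0,f_0\}$ such that $\langle a_0,b_0,e_0,f_0\mid R_0\rangle$ defines $\mathcal{PT}(\Omega_{n-1})\zeta$ on the transformations $a_0,b_0,e_0,f_0$, and let $R_{\mathrm s}$ be $R_0$ together with the relations $$d^2=d,\quad a_0d=da_0,\quad b_0d=db_0,\quad e_0d=de_0,\quad f_0d=df_0,$$ $$a_0z=z,\quad b_0z=z,\quad e_0z=z,\quad dz=zf_0,\quad zd=(f_0b_0)^{n-1}z,\quad z^2=(e_0b_0)^{n-3}e_0,\quad d(f_0b_0)^{n-1}z=d(f_0b_0)^{n-1}.$$ Then the presentation $\langle a_0,b_0,e_0,f_0,d,z\mid R_{\mathrm s}\rangle$ defines the monoid $\mathrm{PsEnd}(S_n)$ on the transformations $a_0,b_0,e_0,f_0,d,z$. Moreover, $|\mathrm{PsEnd}(S_n)|=2n^{n-1}+n2^{n-1}-1$.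 -/

import Mathlib

namespace StarMonoid

/-! Partial transformations. -/

/-- A partial transformation of `V`: `α v = none` means that `v` is not in the domain of `α`,
and `α v = some w` means that `v` is in the domain and has image `w`. -/
@[ext]
structure PT (V : Type*) where
  toFun : V → Option V

instance (V : Type*) : CoeFun (PT V) (fun _ => V → Option V) := ⟨PT.toFun⟩

/-- Partial transformations act on the right: `α * β` is first `α`, then `β`. -/
instance (V : Type*) : Monoid (PT V) where
  mul α β := ⟨fun v => (α v).bind β⟩
  one := ⟨fun v => some v⟩
  mul_assoc α β γ := PT.ext (funext fun v => Option.bind_assoc (α v) β γ)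
  one_mul _ := rfl
  mul_one α := PT.ext (funext fun v => Option.bind_fun_some (α v))

theorem PT.mul_apply {V : Type*} (α β : PT V) (v : V) : (α * β) v = (α v).bind β := rfl

theorem PT.one_apply {V : Type*} (v : V) : (1 : PT V) v = some v := rfl

/-- The monoid of partial strong endomorphisms of a simple graph `G`: the partial transformations
`α` such that, for all `u`, `v` in the domain of `α`, the pair `{u, v}` is an edge if and only if
`{uα, vα}` is an edge. -/
def PsEnd {V : Type*} (G : SimpleGraph V) : Submonoid (PT V) where
  carrier := {α | ∀ u v u' v' : V, α u = some u' → α v = some v' → (G.Adj u v ↔ G.Adj u' v')}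
  one_mem' := by
    intro u v u' v' hu hv
    rw [PT.one_apply, Option.some.injEq] at hu hv
    rw [hu, hv]
  mul_mem' := by
    intro α β hα hβ u v u' v' hu hv
    rw [PT.mul_apply, Option.bind_eq_some_iff] at hu hv
    obtain ⟨x, hux, hxu⟩ := hu
    obtain ⟨y, hvy, hyv⟩ := hv
    exact (hα u v x y hux hvy).trans (hβ x y u' v' hxu hyv)

/-! The vertex set `{0, 1, …, n - 1}` of the star graph is `Fin n`. -/

section Star

variable (n : ℕ) [NeZero n]

/-- The star graph with vertices `0, 1, …, n - 1` and edges `{0, i}` for `1 ≤ i ≤ n - 1`. -/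
abbrev S : SimpleGraph (Fin n) := SimpleGraph.starGraph 0

/-- The map `α ↦ ζ_α`: put `0` in the domain, fix `0`, and leave `α` as it is elsewhere. -/
def zeta (α : PT (Fin n)) : PT (Fin n) := ⟨fun i => if i = 0 then some 0 else α i⟩

/-- The partial transformations of `{1, …, n - 1}`, seen as partial transformations of
`{0, …, n - 1}` whose domain and image do not contain `0`. -/
def PTPos : Set (PT (Fin n)) := {α | α 0 = none ∧ ∀ i, α i ≠ some 0}

/-- The image under `ζ` of the partial transformations of `{1, …, n - 1}`. -/
def PTZeta : Submonoid (PT (Fin n)) where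
  carrier := zeta n '' PTPos n
  one_mem' := by
    refine ⟨⟨fun i => if i = 0 then none else some i⟩, ⟨by simp, fun i => ?_⟩, ?_⟩
    · dsimp only
      split_ifs with h <;> simp [h]
    · ext1
      funext i
      by_cases h : i = 0 <;> simp [zeta, PT.one_apply, h]
  mul_mem' := by
    rintro _ _ ⟨α, ⟨hα0, hα⟩, rfl⟩ ⟨β, ⟨hβ0, hβ⟩, rfl⟩
    refine ⟨α * β, ⟨?_, fun i => ?_⟩, ?_⟩
    · rw [PT.mul_apply, hα0]
      rfl
    · rw [PT.mul_apply]
      cases h : α i with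
      | none => simp
      | some j => exact hβ j
    · ext1
      funext i
      by_cases h : i = 0
      · simp [zeta, PT.mul_apply, h]
      · simp only [zeta, if_neg h, PT.mul_apply]
        cases hj : α i with
        | none => rfl
        | some j =>
          have hj0 : j ≠ 0 := by
            rintro rfl
            exact hα i hj
          simp [hj0]

/-- The transposition of `1` and `2`, on `{1, …, n - 1}`. -/
def a : PT (Fin n) := ⟨fun i =>
  if i = 0 then none else if i = 1 then some 2 else if i = 2 then some 1 else some i⟩

/-- The cycle `1 ↦ 2 ↦ ⋯ ↦ n - 1 ↦ 1`, on `{1, …, n - 1}`.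
Addition in `Fin n` is modulo `n`, so `i + 1 = 0` means `i = n - 1`. -/
def b : PT (Fin n) := ⟨fun i =>
  if i = 0 then none else if i + 1 = 0 then some 1 else some (i + 1)⟩

/-- The map `2 ↦ 1` and `i ↦ i` for `i ≠ 2`, on `{1, …, n - 1}`. -/
def e : PT (Fin n) := ⟨fun i =>
  if i = 0 then none else if i = 2 then some 1 else some i⟩

/-- The partial identity with domain `{2, …, n - 1}`. -/
def f : PT (Fin n) := ⟨fun i =>
  if i = 0 then none else if i = 1 then none else some i⟩

/-- The partial identity with domain `{1, …, n - 1}`. -/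
def d : PT (Fin n) := ⟨fun i => if i = 0 then none else some i⟩

/-- The full transformation `0 ↦ 1` and `i ↦ 0` for `1 ≤ i ≤ n - 1`. -/
def z : PT (Fin n) := ⟨fun i => if i = 0 then some 1 else some 0⟩

end Star

/-! Presentations. -/

/-- The monoid presentation `⟨A | R⟩` defines the submonoid `N` of `M` on the generators `g x`,
`x ∈ A`: there is an isomorphism from `A* / ∼_R` onto `N`, where `∼_R` is the congruence on the
free monoid `A*` generated by `R`, that maps the class of each letter `x` to `g x`. -/
def Defines {A M : Type*} [Monoid M] (R : FreeMonoid A → FreeMonoid A → Prop)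
    (g : A → M) (N : Submonoid M) : Prop :=
  ∃ φ : PresentedMonoid R ≃* N, ∀ x : A, (φ (PresentedMonoid.of R x) : M) = g x

/-- The alphabet `{a₀, b₀, e₀, f₀}`. -/
inductive Gen₀
  | a₀ | b₀ | e₀ | f₀

/-- The alphabet `{a₀, b₀, e₀, f₀, d, z}`. -/
inductive Gen
  | a₀ | b₀ | e₀ | f₀ | d | z

/-- The transformations `a₀ = ζ_a`, `b₀ = ζ_b`, `e₀ = ζ_e`, `f₀ = ζ_f`. -/
def val₀ (n : ℕ) [NeZero n] : Gen₀ → PT (Fin n)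
  | .a₀ => zeta n (a n)
  | .b₀ => zeta n (b n)
  | .e₀ => zeta n (e n)
  | .f₀ => zeta n (f n)

/-- The transformations `a₀`, `b₀`, `e₀`, `f₀`, `d`, `z`. -/
def val (n : ℕ) [NeZero n] : Gen → PT (Fin n)
  | .a₀ => zeta n (a n)
  | .b₀ => zeta n (b n)
  | .e₀ => zeta n (e n)
  | .f₀ => zeta n (f n)
  | .d => d n
  | .z => z n

/-- The inclusion of the alphabet `{a₀, b₀, e₀, f₀}` in `{a₀, b₀, e₀, f₀, d, z}`. -/
def Gen₀.toGen : Gen₀ → Gen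
  | .a₀ => .a₀
  | .b₀ => .b₀
  | .e₀ => .e₀
  | .f₀ => .f₀

/-- The letter `a₀`, as a word. -/
abbrev A₀ : FreeMonoid Gen := FreeMonoid.of .a₀
/-- The letter `b₀`, as a word. -/
abbrev B₀ : FreeMonoid Gen := FreeMonoid.of .b₀
/-- The letter `e₀`, as a word. -/
abbrev E₀ : FreeMonoid Gen := FreeMonoid.of .e₀
/-- The letter `f₀`, as a word. -/
abbrev F₀ : FreeMonoid Gen := FreeMonoid.of .f₀
/-- The letter `d`, as a word. -/
abbrev D : FreeMonoid Gen := FreeMonoid.of .d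
/-- The letter `z`, as a word. -/
abbrev Z : FreeMonoid Gen := FreeMonoid.of .z

/-- The set of relations `R_s` obtained from a set `R₀` of relations on `{a₀, b₀, e₀, f₀}`. -/
inductive Rs (n : ℕ) (R₀ : FreeMonoid Gen₀ → FreeMonoid Gen₀ → Prop) :
    FreeMonoid Gen → FreeMonoid Gen → Prop
  | base (u v : FreeMonoid Gen₀) (h : R₀ u v) :
      Rs n R₀ (FreeMonoid.map Gen₀.toGen u) (FreeMonoid.map Gen₀.toGen v)
  | d_sq : Rs n R₀ (D ^ 2) D
  | a_d : Rs n R₀ (A₀ * D) (D * A₀)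
  | b_d : Rs n R₀ (B₀ * D) (D * B₀)
  | e_d : Rs n R₀ (E₀ * D) (D * E₀)
  | f_d : Rs n R₀ (F₀ * D) (D * F₀)
  | a_z : Rs n R₀ (A₀ * Z) Z
  | b_z : Rs n R₀ (B₀ * Z) Z
  | e_z : Rs n R₀ (E₀ * Z) Z
  | d_z : Rs n R₀ (D * Z) (Z * F₀)
  | z_d : Rs n R₀ (Z * D) ((F₀ * B₀) ^ (n - 1) * Z)
  | z_sq : Rs n R₀ (Z ^ 2) ((E₀ * B₀) ^ (n - 3) * E₀)
  | d_f_b_z : Rs n R₀ (D * (F₀ * B₀) ^ (n - 1) * Z) (D * (F₀ * B₀) ^ (n - 1))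

end StarMonoid

namespace StarMonoid

section Star

variable {n : ℕ} [NeZero n]

/-! A strong partial endomorphism of a star is governed by its value at the centre `0`
(`mem_PsEnd_star`): it fixes `0` and keeps leaves off `0`, or swaps the roles of centre and leaves,
or is undefined at `0` and has image either avoiding `0` or inside `{0}`. So each one is `w`, `w *
d` or `v * z * w` with `v`, `w` in `PTZeta n`. The presented monoid has the same normal forms. Since
`z` absorbs `collapse` on both sides, `v * z` depends only on the domain of `v`, and `z * w` only on
the value of `w` at `1` (`mul_z_eq`, `z_mul_eq`). Hence left multiplication by a generator preserves
normal forms, and evaluation separates them: the only overlap between families is the empty map,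
settled by the last relation of `Rs` (`d_mul_isolate`). The count comes from the choice of value at
`0`. -/

theorem mem_PTZeta {α : PT (Fin n)} :
    α ∈ PTZeta n ↔ α 0 = some 0 ∧ ∀ i, i ≠ 0 → α i ≠ some 0 := by
  constructor
  · rintro ⟨β, ⟨-, hβ⟩, rfl⟩
    exact ⟨by simp [zeta], fun i hi => by simpa [zeta, hi] using hβ i⟩
  · rintro ⟨h0, h⟩
    refine ⟨⟨fun i => if i = 0 then none else α i⟩, ⟨by simp, fun i => ?_⟩, ?_⟩
    · by_cases hi : i = 0
      · simp [hi]
      · simpa [hi] using h i hi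
    · ext1
      funext i
      by_cases hi : i = 0 <;> simp [zeta, hi, h0]

/-- Every edge contains `0`. A leaf image of `0` has `0` as its only neighbour; if `0` is outside
the domain, the domain is independent, so the image must be too. -/
theorem mem_PsEnd_star {α : PT (Fin n)} :
    α ∈ PsEnd (S n) ↔
      (α 0 = some 0 ∧ ∀ i, i ≠ 0 → α i ≠ some 0) ∨
      ((∃ j, j ≠ 0 ∧ α 0 = some j) ∧ ∀ i, i ≠ 0 → α i = none ∨ α i = some 0) ∨
      (α 0 = none ∧ ((∀ i, i ≠ 0 → α i ≠ some 0) ∨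
        ∀ i, i ≠ 0 → α i = none ∨ α i = some 0)) := by
  constructor
  · intro h
    replace h : ∀ u v u' v', α u = some u' → α v = some v' →
      ((u ≠ v ∧ (u = 0 ∨ v = 0)) ↔ (u' ≠ v' ∧ (u' = 0 ∨ v' = 0))) := by
      intro u v u' v' hu hv
      simpa using h u v u' v' hu hv
    cases h0 : α 0 with
    | none =>
      refine Or.inr (Or.inr ⟨rfl, ?_⟩)
      by_contra! hc
      obtain ⟨⟨i, hi, hi0⟩, j, hj, hjn, hj0⟩ := hc
      obtain ⟨k, hk⟩ := Option.ne_none_iff_exists'.1 hjn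
      have := h i j 0 k hi0 hk
      grind
    | some j =>
      by_cases hj : j = 0
      · subst hj
        refine Or.inl ⟨rfl, fun i hi hi0 => ?_⟩
        have := h 0 i 0 0 h0 hi0
        grind
      · refine Or.inr (Or.inl ⟨⟨j, hj, rfl⟩, fun i hi => ?_⟩)
        cases hk : α i with
        | none => simp
        | some k =>
          have := h 0 i j k h0 hk
          grind
  · intro h u v u' v' hu hv
    simp only [SimpleGraph.starGraph_adj]
    by_cases hu0 : u = 0 <;> by_cases hv0 : v = 0 <;> grind

/-! ### Arithmetic in `Fin n` -/

theorem one_val (hn : 3 ≤ n) : ((1 : Fin n) : ℕ) = 1 := by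
  rw [Fin.val_one', Nat.mod_eq_of_lt (by omega)]

theorem two_val (hn : 3 ≤ n) : ((2 : Fin n) : ℕ) = 2 := by
  exact Nat.mod_eq_of_lt (by omega : 2 < n)

theorem one_ne_zero_fin (hn : 3 ≤ n) : (1 : Fin n) ≠ 0 := by
  rw [Ne, Fin.ext_iff, one_val hn, Fin.val_zero]; omega

theorem two_ne_zero_fin (hn : 3 ≤ n) : (2 : Fin n) ≠ 0 := by
  rw [Ne, Fin.ext_iff, two_val hn, Fin.val_zero]; omega

theorem two_ne_one_fin (hn : 3 ≤ n) : (2 : Fin n) ≠ 1 := by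
  rw [Ne, Fin.ext_iff, two_val hn, one_val hn]; omega

theorem one_add_one_fin : (1 : Fin n) + 1 = 2 := by
  ext
  rw [Fin.val_add, Fin.val_one', ← Nat.add_mod]
  rfl

theorem add_one_eq_zero_iff (hn : 3 ≤ n) (i : Fin n) : i + 1 = 0 ↔ (i : ℕ) = n - 1 := by
  rw [Fin.ext_iff, Fin.val_add, one_val hn, Fin.val_zero]
  have := i.2
  constructor
  · intro h
    by_contra hc
    rw [Nat.mod_eq_of_lt (by omega)] at h
    omega
  · intro h
    rw [h, Nat.sub_add_cancel (by omega), Nat.mod_self]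

theorem add_one_val (hn : 3 ≤ n) {i : Fin n} (h : i + 1 ≠ 0) : ((i + 1 : Fin n) : ℕ) = i + 1 := by
  rw [Ne, add_one_eq_zero_iff hn] at h
  rw [Fin.val_add, one_val hn, Nat.mod_eq_of_lt (by omega)]

/-! ### Words for `isolate` and `collapse` -/

variable (n) in
/-- The transformation fixing `0` and sending every other vertex to `1`. -/
def collapse : PT (Fin n) := ⟨fun i => if i = 0 then some 0 else some 1⟩

variable (n) in
/-- The partial identity with domain `{0}`. -/
def isolate : PT (Fin n) := ⟨fun i => if i = 0 then some 0 else none⟩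

theorem zeta_f_mul_zeta_b_apply (hn : 3 ≤ n) (i : Fin n) :
    (zeta n (f n) * zeta n (b n)) i =
      if i = 0 then some 0 else if i = 1 then none else
        if i + 1 = 0 then some 1 else some (i + 1) := by
  have := one_ne_zero_fin hn
  by_cases h : i = 0
  · simp [PT.mul_apply, zeta, h]
  · by_cases h1 : i = 1 <;> simp [PT.mul_apply, zeta, f, b, h, h1, this]

theorem zeta_e_mul_zeta_b_apply (hn : 3 ≤ n) (i : Fin n) :
    (zeta n (e n) * zeta n (b n)) i =
      if i = 0 then some 0 else if i = 2 then some 2 else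
        if i + 1 = 0 then some 1 else some (i + 1) := by
  have h10 := one_ne_zero_fin hn
  have h20 := two_ne_zero_fin hn
  by_cases h : i = 0
  · simp [PT.mul_apply, zeta, h]
  · by_cases h2 : i = 2 <;> simp [PT.mul_apply, zeta, e, b, h, h2, h10, h20, one_add_one_fin]

/-- Each factor deletes `1` and shifts the other leaves cyclically. A leaf `i ≥ 2` reaches `1` after
`n - i` steps and is deleted at the next, so `i = 2` needs exactly `n - 1`. -/
theorem pow_f_b (hn : 3 ≤ n) : (zeta n (f n) * zeta n (b n)) ^ (n - 1) = isolate n := by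
  have h0 : ∀ k, ((zeta n (f n) * zeta n (b n)) ^ k) 0 = some 0 := by
    intro k
    induction k with
    | zero => rw [pow_zero, PT.one_apply]
    | succ k ih => rw [pow_succ', PT.mul_apply, zeta_f_mul_zeta_b_apply hn]; simpa using ih
  have h1 : ∀ k, ((zeta n (f n) * zeta n (b n)) ^ (k + 1)) 1 = none := by
    intro k
    rw [pow_succ', PT.mul_apply, zeta_f_mul_zeta_b_apply hn]
    simp [one_ne_zero_fin hn]
  have h2 : ∀ k (i : Fin n), 2 ≤ (i : ℕ) → n + 1 ≤ k + i →
      ((zeta n (f n) * zeta n (b n)) ^ k) i = none := by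
    intro k
    induction k with
    | zero => intro i _ h; omega
    | succ k ih =>
      intro i hi hk
      have hi0 : i ≠ 0 := by rintro rfl; simp at hi
      have hi1 : i ≠ 1 := by rintro rfl; rw [one_val hn] at hi; omega
      rw [pow_succ', PT.mul_apply, zeta_f_mul_zeta_b_apply hn, if_neg hi0, if_neg hi1]
      split_ifs with h
      · obtain ⟨k, rfl⟩ : ∃ l, k = l + 1 := ⟨k - 1, by omega⟩
        exact h1 k
      · have := add_one_val hn h
        exact ih _ (by omega) (by omega)
  ext1
  funext i
  by_cases hi : i = 0
  · simp [hi, h0, isolate]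
  · by_cases hi1 : i = 1
    · rw [hi1, show n - 1 = (n - 2) + 1 by omega, h1]
      simp [isolate, one_ne_zero_fin hn]
    · rw [h2]
      · simp [isolate, hi]
      all_goals
        rw [Fin.ext_iff, one_val hn] at hi1
        rw [Fin.ext_iff, Fin.val_zero] at hi
        omega

/-- Each factor fixes `2`, sends `1` to `2` and shifts the other leaves. After `n - 3` factors every
leaf is at `1` or `2`, and the final `e` merges these. -/
theorem pow_e_b (hn : 3 ≤ n) :
    (zeta n (e n) * zeta n (b n)) ^ (n - 3) * zeta n (e n) = collapse n := by
  have h10 := one_ne_zero_fin hn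
  have h20 := two_ne_zero_fin hn
  have h21 := two_ne_one_fin hn
  have h0 : ∀ k, ((zeta n (e n) * zeta n (b n)) ^ k * zeta n (e n)) 0 = some 0 := by
    intro k
    induction k with
    | zero => simp [zeta]
    | succ k ih =>
      rw [pow_succ', mul_assoc, PT.mul_apply, zeta_e_mul_zeta_b_apply hn]; simpa using ih
  have h2 : ∀ k, ((zeta n (e n) * zeta n (b n)) ^ k * zeta n (e n)) 2 = some 1 := by
    intro k
    induction k with
    | zero => simp [zeta, e, h20]
    | succ k ih =>
      rw [pow_succ', mul_assoc, PT.mul_apply, zeta_e_mul_zeta_b_apply hn]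
      simpa [h20] using ih
  have h1 : ∀ k, ((zeta n (e n) * zeta n (b n)) ^ k * zeta n (e n)) 1 = some 1 := by
    rintro (_ | k)
    · simp [zeta, e, h10, h21.symm]
    · rw [pow_succ', mul_assoc, PT.mul_apply, zeta_e_mul_zeta_b_apply hn]
      simpa [h10, h21.symm, one_add_one_fin, h20] using h2 k
  have h3 : ∀ k (i : Fin n), 3 ≤ (i : ℕ) → n ≤ k + i →
      ((zeta n (e n) * zeta n (b n)) ^ k * zeta n (e n)) i = some 1 := by
    intro k
    induction k with
    | zero => intro i _ h; omega
    | succ k ih =>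
      intro i hi hk
      have hi0 : i ≠ 0 := by rintro rfl; simp at hi
      have hi2 : i ≠ 2 := by rintro rfl; rw [two_val hn] at hi; omega
      rw [pow_succ', mul_assoc, PT.mul_apply, zeta_e_mul_zeta_b_apply hn, if_neg hi0, if_neg hi2]
      split_ifs with h
      · exact h1 k
      · have := add_one_val hn h
        exact ih _ (by omega) (by omega)
  ext1
  funext i
  by_cases hi : i = 0
  · simp [hi, h0, collapse]
  · rw [show (collapse n) i = some 1 by simp [collapse, hi]]
    by_cases hi1 : i = 1
    · rw [hi1, h1]
    by_cases hi2 : i = 2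
    · rw [hi2, h2]
    rw [Fin.ext_iff, one_val hn] at hi1
    rw [Fin.ext_iff, two_val hn] at hi2
    rw [Fin.ext_iff, Fin.val_zero] at hi
    exact h3 _ _ (by omega) (by omega)

/-! ### Soundness of the generators and relations -/

theorem val_mem_PsEnd (hn : 3 ≤ n) (x : Gen) : val n x ∈ PsEnd (S n) := by
  have h10 := one_ne_zero_fin hn
  rw [mem_PsEnd_star]
  cases x <;> simp only [val]
  · left
    refine ⟨by simp [zeta], fun i hi => ?_⟩
    have h20 := two_ne_zero_fin hn
    simp only [zeta, a]
    grind
  · left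
    refine ⟨by simp [zeta], fun i hi => ?_⟩
    simp only [zeta, b]
    grind
  · left
    refine ⟨by simp [zeta], fun i hi => ?_⟩
    simp only [zeta, e]
    grind
  · left
    refine ⟨by simp [zeta], fun i hi => ?_⟩
    simp only [zeta, f]
    grind
  · right; right
    refine ⟨by simp [d], Or.inl fun i hi => ?_⟩
    simp [d, hi]
  · right; left
    exact ⟨⟨1, h10, by simp [z]⟩, fun i hi => by simp [z, hi]⟩

theorem mul_d_apply (α : PT (Fin n)) (i : Fin n) :
    (α * d n) i = (α i).bind fun j => if j = 0 then none else some j := rfl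

theorem d_mul_apply (α : PT (Fin n)) (i : Fin n) :
    (d n * α) i = if i = 0 then none else α i := by
  by_cases h : i = 0 <;> simp [PT.mul_apply, d, h]

theorem mul_d_comm {α : PT (Fin n)} (h : α ∈ PTZeta n) : α * d n = d n * α := by
  rw [mem_PTZeta] at h
  ext1
  funext i
  rw [mul_d_apply, d_mul_apply]
  by_cases hi : i = 0
  · simp [hi, h.1]
  · have := h.2 i hi
    cases hj : α i with
    | none => simp [hi]
    | some j =>
      have hj0 : j ≠ 0 := by rintro rfl; exact this hj
      simp [hi, hj0]

theorem mul_z_apply {α : PT (Fin n)} (h : α ∈ PTZeta n) (i : Fin n) :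
    (α * z n) i = if i = 0 then some 1 else (α i).map fun _ => 0 := by
  rw [mem_PTZeta] at h
  rw [PT.mul_apply]
  by_cases hi : i = 0
  · simp [hi, h.1, z]
  · have := h.2 i hi
    cases hj : α i with
    | none => simp [hi]
    | some j =>
      have hj0 : j ≠ 0 := by rintro rfl; exact this hj
      simp [hi, hj0, z]

theorem z_mul_apply {α : PT (Fin n)} (h : α ∈ PTZeta n) (i : Fin n) :
    (z n * α) i = if i = 0 then α 1 else some 0 := by
  rw [PT.mul_apply]
  by_cases hi : i = 0 <;> simp [hi, z, (mem_PTZeta.1 h).1]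

theorem mul_z_mul_apply {α β : PT (Fin n)} (hα : α ∈ PTZeta n) (hβ : β ∈ PTZeta n) (i : Fin n) :
    (α * z n * β) i = if i = 0 then β 1 else (α i).map fun _ => 0 := by
  rw [PT.mul_apply, mul_z_apply hα]
  by_cases hi : i = 0
  · simp [hi]
  · cases α i <;> simp [hi, (mem_PTZeta.1 hβ).1]

theorem val_toGen (x : Gen₀) : val n x.toGen = val₀ n x := by cases x <;> rfl

theorem val₀_mem_PTZeta (hn : 3 ≤ n) (x : Gen₀) : val₀ n x ∈ PTZeta n := by
  have h10 := one_ne_zero_fin hn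
  have h20 := two_ne_zero_fin hn
  rw [mem_PTZeta]
  cases x <;> simp only [val₀] <;> refine ⟨by simp [zeta], fun i hi => ?_⟩ <;>
    simp only [zeta, a, b, e, f] <;> grind

theorem isolate_mem : isolate n ∈ PTZeta n :=
  mem_PTZeta.2 ⟨by simp [isolate], fun i hi => by simp [isolate, hi]⟩

theorem collapse_mem (hn : 3 ≤ n) : collapse n ∈ PTZeta n :=
  mem_PTZeta.2 ⟨by simp [collapse], fun i hi => by simp [collapse, hi, one_ne_zero_fin hn]⟩

theorem val_respects_Rs (hn : 3 ≤ n) {R₀ : FreeMonoid Gen₀ → FreeMonoid Gen₀ → Prop}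
    (h₀ : ∀ u v, R₀ u v → FreeMonoid.lift (val₀ n) u = FreeMonoid.lift (val₀ n) v)
    (u v : FreeMonoid Gen) (h : Rs n R₀ u v) :
    FreeMonoid.lift (val n) u = FreeMonoid.lift (val n) v := by
  have hA := val₀_mem_PTZeta hn .a₀
  have hB := val₀_mem_PTZeta hn .b₀
  have hE := val₀_mem_PTZeta hn .e₀
  have hF := val₀_mem_PTZeta hn .f₀
  simp only [val₀] at hA hB hE hF
  have h10 := one_ne_zero_fin hn
  cases h with
  | base u v h =>
    have key : (FreeMonoid.lift (val n)).comp (FreeMonoid.map Gen₀.toGen) =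
        FreeMonoid.lift (val₀ n) := FreeMonoid.hom_eq fun x => by simp [val_toGen]
    have := h₀ u v h
    rwa [← key] at this
  | d_sq =>
    simp only [map_mul, FreeMonoid.lift_eval_of, val, pow_two]
    ext1; funext i
    rw [d_mul_apply]
    by_cases hi : i = 0 <;> simp [hi, d]
  | a_d => simpa [val] using mul_d_comm hA
  | b_d => simpa [val] using mul_d_comm hB
  | e_d => simpa [val] using mul_d_comm hE
  | f_d => simpa [val] using mul_d_comm hF
  | a_z =>
    simp only [map_mul, FreeMonoid.lift_eval_of, val]
    ext1; funext i
    rw [mul_z_apply hA]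
    simp only [zeta, a, z]
    grind
  | b_z =>
    simp only [map_mul, FreeMonoid.lift_eval_of, val]
    ext1; funext i
    rw [mul_z_apply hB]
    simp only [zeta, b, z]
    grind
  | e_z =>
    simp only [map_mul, FreeMonoid.lift_eval_of, val]
    ext1; funext i
    rw [mul_z_apply hE]
    simp only [zeta, e, z]
    grind
  | d_z =>
    simp only [map_mul, FreeMonoid.lift_eval_of, val]
    ext1; funext i
    rw [d_mul_apply, z_mul_apply hF]
    simp only [zeta, f, z]
    grind
  | z_d =>
    simp only [map_mul, map_pow, FreeMonoid.lift_eval_of, val, pow_f_b hn]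
    ext1; funext i
    rw [mul_z_apply isolate_mem, mul_d_apply]
    simp only [isolate, z]
    by_cases hi : i = 0 <;> simp [hi, h10]
  | z_sq =>
    simp only [map_mul, map_pow, FreeMonoid.lift_eval_of, val, pow_e_b hn, pow_two]
    ext1; funext i
    simp only [collapse, z, PT.mul_apply]
    by_cases hi : i = 0 <;> simp [hi, h10]
  | d_f_b_z =>
    simp only [map_mul, map_pow, FreeMonoid.lift_eval_of, val, pow_f_b hn]
    ext1; funext i
    rw [mul_assoc, d_mul_apply, d_mul_apply, mul_z_apply isolate_mem]
    by_cases hi : i = 0 <;> simp [hi, isolate]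

/-! ### Cardinality -/

/-- The cardinality of the monoid of partial strong endomorphisms of the star on `m + 1`
vertices. -/
theorem card_PsEnd_star_succ (m : ℕ) :
    Nat.card (PsEnd (S (m + 1))) = 2 * (m + 1) ^ m + (m + 1) * 2 ^ m - 1 := by
  classical
  let A : Finset (Fin m → Option (Fin (m + 1))) :=
    Fintype.piFinset fun _ => Finset.univ.erase (some 0)
  let B : Finset (Fin m → Option (Fin (m + 1))) := Fintype.piFinset fun _ => {none, some 0}
  -- The admissible restrictions to the leaves when the value at `0` is `x`.
  let F : Option (Fin (m + 1)) → Finset (Fin m → Option (Fin (m + 1))) := fun x =>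
    if x = none then A ∪ B else if x = some 0 then A else B
  have hA : A.card = (m + 1) ^ m := by
    simp [A, Fintype.card_piFinset]
  have hB : B.card = 2 ^ m := by
    simp [B, Fintype.card_piFinset]
  have hAB : (A ∩ B).card = 1 := by
    rw [Finset.card_eq_one]
    refine ⟨fun _ => none, ?_⟩
    ext g
    simp only [A, B, Finset.mem_inter, Fintype.mem_piFinset, Finset.mem_erase, Finset.mem_univ,
      and_true, Finset.mem_insert, Finset.mem_singleton, funext_iff, ← forall_and]
    exact forall_congr' fun i => by grind
  have hU : (A ∪ B).card = (m + 1) ^ m + 2 ^ m - 1 := by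
    have := Finset.card_union_add_card_inter A B
    omega
  have hcard : (Finset.univ.sigma F).card = 2 * (m + 1) ^ m + (m + 1) * 2 ^ m - 1 := by
    -- Positivity keeps the truncated subtraction in `hU` exact.
    have h1 : 1 ≤ (m + 1) ^ m := Nat.one_le_pow _ _ (by omega)
    rw [Finset.card_sigma, Fintype.sum_option, Fin.sum_univ_succ]
    simp only [F, if_true, hU, hA, hB, reduceCtorEq, if_false, Option.some.injEq,
      Fin.succ_ne_zero, Finset.sum_const, Finset.card_univ, Fintype.card_fin, smul_eq_mul, add_mul,
      one_mul, two_mul]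
    omega
  let E : PT (Fin (m + 1)) ≃ (_ : Option (Fin (m + 1))) × (Fin m → Option (Fin (m + 1))) :=
    { toFun := fun α => ⟨α 0, fun i => α i.succ⟩
      invFun := fun p => ⟨Fin.cons p.1 p.2⟩
      left_inv := fun α => PT.ext (Fin.cons_self_tail α.toFun)
      right_inv := fun p => by simp }
  have hE : ∀ α, α ∈ PsEnd (S (m + 1)) ↔ E α ∈ Finset.univ.sigma F := by
    intro α
    have hsucc : ∀ p : Fin (m + 1) → Prop, (∀ i, i ≠ 0 → p i) ↔ ∀ i : Fin m, p i.succ :=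
      fun p => by simp [Fin.forall_fin_succ]
    rw [mem_PsEnd_star, hsucc, hsucc]
    simp only [E, F, Equiv.coe_fn_mk, Finset.mem_sigma, Finset.mem_univ, true_and]
    rcases h0 : α 0 with _ | j
    · simp [A, B]
    · by_cases hj : j = 0 <;> simp [A, B, hj]
  rw [← hcard, ← Nat.card_eq_finsetCard]
  exact Nat.card_congr (E.subtypeEquiv hE)

theorem card_PsEnd_star : Nat.card (PsEnd (S n)) = 2 * n ^ (n - 1) + n * 2 ^ (n - 1) - 1 := by
  obtain ⟨m, rfl⟩ := Nat.exists_eq_succ_of_ne_zero (NeZero.ne n)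
  exact card_PsEnd_star_succ m

/-! ### Normal forms from the relations -/

variable (n) in
/-- `isolate n` as an element of `PTZeta n`. -/
abbrev isolateZeta : PTZeta n := ⟨isolate n, isolate_mem⟩

/-- `collapse n` as an element of `PTZeta n`. -/
abbrev collapseZeta (hn : 3 ≤ n) : PTZeta n := ⟨collapse n, collapse_mem hn⟩

/-- The relations satisfied by `d`, `z` and the image of `PTZeta n` in the presented monoid. -/
structure StarRelations (hn : 3 ≤ n) {P : Type*} [Monoid P] (ι : PTZeta n →* P) (d z : P) :
    Prop where
  d_sq : d * d = d
  comm : ∀ w, ι w * d = d * ι w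
  collapse_z : ι (collapseZeta hn) * z = z
  z_sq : z * z = ι (collapseZeta hn)
  d_z : d * z = z * ι ⟨zeta n (f n), val₀_mem_PTZeta hn .f₀⟩
  z_d : z * d = ι (isolateZeta n) * z
  d_isolate_z : d * ι (isolateZeta n) * z = d * ι (isolateZeta n)

namespace StarRelations

variable {hn : 3 ≤ n} {P : Type*} [Monoid P] {ι : PTZeta n →* P} {d z : P}

/-- As `collapse` is the square of `z`, it commutes with `z`; left absorption becomes right
absorption. -/
theorem z_collapse (h : StarRelations hn ι d z) : z * ι (collapseZeta hn) = z := by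
  rw [← h.z_sq, ← mul_assoc, h.z_sq, h.collapse_z]

theorem collapse_mul_eq {v w : PTZeta n} (h : v.1 1 = w.1 1) : collapseZeta hn * v = collapseZeta hn * w := by
  ext1; ext1; funext i
  have hv := (mem_PTZeta.1 v.2).1
  have hw := (mem_PTZeta.1 w.2).1
  by_cases hi : i = 0 <;> simp [PT.mul_apply, collapse, hi, hv, hw, h]

theorem mul_collapse_eq {v w : PTZeta n} (h : ∀ i, i ≠ 0 → (v.1 i = none ↔ w.1 i = none)) :
    v * collapseZeta hn = w * collapseZeta hn := by
  ext1; ext1; funext i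
  have hv := mem_PTZeta.1 v.2
  have hw := mem_PTZeta.1 w.2
  simp only [Submonoid.coe_mul, PT.mul_apply]
  by_cases hi : i = 0
  · simp [hi, hv.1, hw.1]
  · have h1 := h i hi
    have h2 := hv.2 i hi
    have h3 := hw.2 i hi
    cases hv' : v.1 i <;> cases hw' : w.1 i <;> simp [collapse] <;> grind

theorem z_mul_eq (h : StarRelations hn ι d z) {v w : PTZeta n} (hvw : v.1 1 = w.1 1) :
    z * ι v = z * ι w := by
  rw [← h.z_collapse, mul_assoc, mul_assoc, ← map_mul, ← map_mul, collapse_mul_eq hvw]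

theorem mul_z_eq (h : StarRelations hn ι d z) {v w : PTZeta n}
    (hvw : ∀ i, i ≠ 0 → (v.1 i = none ↔ w.1 i = none)) : ι v * z = ι w * z := by
  rw [← h.collapse_z, ← mul_assoc, ← mul_assoc, ← map_mul, ← map_mul, mul_collapse_eq hvw]

theorem d_mul_z (h : StarRelations hn ι d z) : d * z = z * ι (isolateZeta n) := by
  rw [h.d_z]
  apply h.z_mul_eq
  simp [zeta, f, isolate, one_ne_zero_fin hn]

theorem z_mul_of_one_eq_none (h : StarRelations hn ι d z) {w : PTZeta n} (hw : w.1 1 = none) :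
    z * ι w = d * z := by
  rw [h.d_mul_z]
  apply h.z_mul_eq
  simp [hw, isolate, one_ne_zero_fin hn]

/-- Identifies the two normal forms of the empty map. -/
theorem d_mul_isolate (h : StarRelations hn ι d z) : ι (isolateZeta n) * z * ι (isolateZeta n) = ι (isolateZeta n) * d := by
  rw [mul_assoc, ← h.d_mul_z, ← mul_assoc, h.comm, h.d_isolate_z]

/-- `x` is one of the normal forms `w`, `w * d`, `v * z * w` with `v` and `w` in `PTZeta n`. -/
def IsNormal (ι : PTZeta n →* P) (d z x : P) : Prop :=
  (∃ w, x = ι w) ∨ (∃ w, x = ι w * d) ∨ ∃ v w, x = ι v * z * ι w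

theorem isNormal_ι_mul {x : P} (hx : IsNormal ι d z x) (u : PTZeta n) :
    IsNormal ι d z (ι u * x) := by
  obtain ⟨w, rfl⟩ | ⟨w, rfl⟩ | ⟨v, w, rfl⟩ := hx
  · exact Or.inl ⟨u * w, (map_mul ι u w).symm⟩
  · exact Or.inr (Or.inl ⟨u * w, by rw [map_mul, mul_assoc]⟩)
  · exact Or.inr (Or.inr ⟨u * v, w, by simp only [map_mul, mul_assoc]⟩)

theorem isNormal_d_mul (h : StarRelations hn ι d z) {x : P} (hx : IsNormal ι d z x) :
    IsNormal ι d z (d * x) := by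
  obtain ⟨w, rfl⟩ | ⟨w, rfl⟩ | ⟨v, w, rfl⟩ := hx
  · exact Or.inr (Or.inl ⟨w, (h.comm w).symm⟩)
  · exact Or.inr (Or.inl ⟨w, by rw [h.comm, ← mul_assoc, h.d_sq]⟩)
  · refine Or.inr (Or.inr ⟨v, isolateZeta n * w, ?_⟩)
    rw [← mul_assoc, ← mul_assoc, ← h.comm, mul_assoc _ d, h.d_mul_z, map_mul]
    simp only [mul_assoc]

theorem isNormal_z_mul (h : StarRelations hn ι d z) {x : P} (hx : IsNormal ι d z x) :
    IsNormal ι d z (z * x) := by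
  obtain ⟨w, rfl⟩ | ⟨w, rfl⟩ | ⟨v, w, rfl⟩ := hx
  · exact Or.inr (Or.inr ⟨1, w, by simp⟩)
  · refine Or.inr (Or.inr ⟨isolateZeta n, w, ?_⟩)
    rw [h.comm, ← mul_assoc, h.z_d]
  -- In `z * v * z` only the value of `v` at `1` matters: if undefined, `z * v` is `d * z`;
  -- otherwise the product is `z * z`.
  · cases hv : v.1 1 with
    | none =>
      have : z * (ι v * z * ι w) = d * ι (collapseZeta hn * w) := by
        rw [map_mul, ← h.z_sq, ← mul_assoc, ← mul_assoc, h.z_mul_of_one_eq_none hv]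
        simp only [mul_assoc]
      rw [this]
      exact h.isNormal_d_mul (Or.inl ⟨_, rfl⟩)
    | some j =>
      refine Or.inl ⟨collapseZeta hn * w, ?_⟩
      have hκ : collapseZeta hn * v * collapseZeta hn = collapseZeta hn := by
        have hj : j ≠ 0 := by
          rintro rfl
          exact (mem_PTZeta.1 v.2).2 1 (one_ne_zero_fin hn) hv
        have hv0 := (mem_PTZeta.1 v.2).1
        ext1; ext1; funext i
        by_cases hi : i = 0 <;> simp [PT.mul_apply, collapse, hi, hv, hv0, hj]
      calc z * (ι v * z * ι w) = z * ι (collapseZeta hn) * ι v * (ι (collapseZeta hn) * z) * ι w := by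
            rw [h.z_collapse, h.collapse_z]; simp only [mul_assoc]
        _ = z * ι (collapseZeta hn * v * collapseZeta hn) * z * ι w := by simp only [map_mul, mul_assoc]
        _ = ι (collapseZeta hn * w) := by rw [hκ, h.z_collapse, h.z_sq, map_mul]

/-! ### Evaluation of normal forms -/

variable {ε : P →* PT (Fin n)}

/-- A monoid homomorphism to `PT (Fin n)` which is the identity on `PTZeta n` and maps `d` and `z`
to the transformations of the same name separates the normal forms. -/
theorem eq_of_isNormal (h : StarRelations hn ι d z) (hι : ∀ w, ε (ι w) = w)
    (hd : ε d = StarMonoid.d n) (hz : ε z = StarMonoid.z n) {x y : P}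
    (hx : IsNormal ι d z x) (hy : IsNormal ι d z y) (hxy : ε x = ε y) : x = y := by
  have εd : ∀ (w : PTZeta n) i, ε (ι w * d) i = if i = 0 then none else w.1 i := by
    intro w i
    rw [map_mul, hι, hd, mul_d_comm w.2, d_mul_apply]
  have εz : ∀ (v w : PTZeta n) i, ε (ι v * z * ι w) i =
      if i = 0 then w.1 1 else (v.1 i).map fun _ => 0 := by
    intro v w i
    rw [map_mul, map_mul, hι, hι, hz, mul_z_mul_apply v.2 w.2]
  have zero : ∀ w : PTZeta n, w.1 0 = some 0 := fun w => (mem_PTZeta.1 w.2).1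
  have nonzero : ∀ (w : PTZeta n) i, i ≠ 0 → w.1 i ≠ some 0 := fun w => (mem_PTZeta.1 w.2).2
  have h10 := one_ne_zero_fin hn
  -- On leaves one side avoids `0` and the other takes only the value `0`, so both are empty.
  have case_d_z : ∀ u v w, ε (ι u * d) = ε (ι v * z * ι w) → ι u * d = ι v * z * ι w := by
    intro u v w huvw
    have hi : ∀ i, (if i = 0 then none else u.1 i) =
        if i = 0 then w.1 1 else (v.1 i).map fun _ => 0 := fun i => by rw [← εd, ← εz, huvw]
    have hw : w.1 1 = none := by simpa using (hi 0).symm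
    have huv : ∀ i, i ≠ 0 → u.1 i = none ∧ v.1 i = none := by
      intro i h0
      have h1 := hi i
      have h2 := nonzero u i h0
      cases hv : v.1 i <;> simp_all
    have hu : u = isolateZeta n := by
      ext1; ext1; funext i
      by_cases h0 : i = 0
      · simp [h0, isolate, zero u]
      · simp [h0, isolate, huv i h0]
    have hv : v = isolateZeta n := by
      ext1; ext1; funext i
      by_cases h0 : i = 0
      · simp [h0, isolate, zero v]
      · simp [h0, isolate, huv i h0]
    rw [mul_assoc, h.z_mul_of_one_eq_none hw, h.d_mul_z, ← mul_assoc, hu, hv, h.d_mul_isolate]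
  -- The value at `0` tells `w` from the other two families, where it is never `some 0`.
  obtain ⟨w, rfl⟩ | ⟨w, rfl⟩ | ⟨v, w, rfl⟩ := hx <;>
    obtain ⟨w', rfl⟩ | ⟨w', rfl⟩ | ⟨v', w', rfl⟩ := hy
  · rw [hι, hι] at hxy
    rw [Subtype.ext hxy]
  · have := congrArg (fun α : PT (Fin n) => α 0) hxy
    simp only [hι, εd, zero, if_true, reduceCtorEq] at this
  · have := congrArg (fun α : PT (Fin n) => α 0) hxy
    simp only [hι, εz, zero, if_true] at this
    exact absurd this.symm (nonzero w' 1 h10)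
  · have := congrArg (fun α : PT (Fin n) => α 0) hxy
    simp only [hι, εd, zero, if_true, reduceCtorEq] at this
  · congr 2
    ext1; ext1; funext i
    by_cases hi : i = 0
    · rw [hi, zero, zero]
    · have := congrArg (fun α : PT (Fin n) => α i) hxy
      simpa only [εd, if_neg hi] using this
  · exact case_d_z _ _ _ hxy
  · have := congrArg (fun α : PT (Fin n) => α 0) hxy
    simp only [hι, εz, zero, if_true] at this
    exact absurd this (nonzero w 1 h10)
  · exact (case_d_z _ _ _ hxy.symm).symm
  · have hi : ∀ i, (if i = 0 then w.1 1 else (v.1 i).map fun _ => (0 : Fin n)) =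
        if i = 0 then w'.1 1 else (v'.1 i).map fun _ => 0 := fun i => by rw [← εz, ← εz, hxy]
    have h1 : w.1 1 = w'.1 1 := by simpa using hi 0
    rw [mul_assoc, h.z_mul_eq h1, ← mul_assoc, h.mul_z_eq (w := v'), mul_assoc]
    intro i h0
    have := hi i
    rw [if_neg h0, if_neg h0] at this
    rw [← Option.map_eq_none_iff (f := fun _ => (0 : Fin n)), this, Option.map_eq_none_iff]

/-- The identity on the domain of `α` together with `0`. -/
def idOn (α : PT (Fin n)) : PT (Fin n) :=
  ⟨fun i => if i = 0 then some 0 else (α i).map fun _ => i⟩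

theorem idOn_mem (α : PT (Fin n)) : idOn α ∈ PTZeta n := by
  refine mem_PTZeta.2 ⟨by simp [idOn], fun i hi => ?_⟩
  cases h : α i <;> simp [idOn, hi, h]

/-- The transformation fixing `0` and sending every other vertex to `x`, if `x` is a vertex, with
domain `{0}` otherwise. -/
def constOn (x : Option (Fin n)) : PT (Fin n) := ⟨fun i => if i = 0 then some 0 else x⟩

theorem constOn_mem {x : Option (Fin n)} (hx : x ≠ some 0) : constOn x ∈ PTZeta n :=
  mem_PTZeta.2 ⟨by simp [constOn], fun i hi => by simpa [constOn, hi] using hx⟩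

theorem exists_eq_of_mem_PsEnd (hn : 3 ≤ n) (hι : ∀ w, ε (ι w) = w)
    (hd : ε d = StarMonoid.d n) (hz : ε z = StarMonoid.z n) {α : PT (Fin n)}
    (hα : α ∈ PsEnd (S n)) : ∃ x, ε x = α := by
  have key : α 0 ≠ some 0 → (∀ i, i ≠ 0 → α i = none ∨ α i = some 0) → ∃ x, ε x = α := by
    intro h0 h
    -- The left factor carries the domain among the leaves, the right one the value at `0`.
    refine ⟨ι ⟨_, idOn_mem α⟩ * z * ι ⟨_, constOn_mem h0⟩, ?_⟩
    rw [map_mul, map_mul, hι, hι, hz]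
    ext1; funext i
    rw [mul_z_mul_apply (idOn_mem α) (constOn_mem h0)]
    by_cases hi : i = 0
    · simp [hi, constOn, one_ne_zero_fin hn]
    · rcases h i hi with h' | h' <;> simp [hi, idOn, h']
  obtain h | ⟨⟨j, hj, h0⟩, h⟩ | ⟨h0, h | h⟩ := mem_PsEnd_star.1 hα
  · exact ⟨ι ⟨α, mem_PTZeta.2 h⟩, hι _⟩
  · exact key (by simpa [h0] using hj) h
  · have hmem : zeta n α ∈ PTZeta n :=
      mem_PTZeta.2 ⟨by simp [zeta], fun i hi => by simpa [zeta, hi] using h i hi⟩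
    refine ⟨ι ⟨_, hmem⟩ * d, ?_⟩
    rw [map_mul, hι, hd, mul_d_comm hmem]
    ext1; funext i
    rw [d_mul_apply]
    by_cases hi : i = 0 <;> simp [zeta, hi, h0]
  · exact key (by simp [h0]) h

end StarRelations

/-! ### The isomorphism -/

open PresentedMonoid in
theorem defines_Rs (hn : 3 ≤ n) {R₀ : FreeMonoid Gen₀ → FreeMonoid Gen₀ → Prop}
    (hR₀ : Defines R₀ (val₀ n) (PTZeta n)) : Defines (Rs n R₀) (val n) (PsEnd (S n)) := by
  obtain ⟨φ, hφ⟩ := hR₀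
  have h₀ : ∀ u v, R₀ u v → FreeMonoid.lift (val₀ n) u = FreeMonoid.lift (val₀ n) v := by
    have key : FreeMonoid.lift (val₀ n) =
        ((PTZeta n).subtype.comp φ.toMonoidHom).comp (mk R₀) :=
      FreeMonoid.hom_eq fun x => by
        rw [FreeMonoid.lift_eval_of]
        exact (hφ x).symm
    intro u v h
    rw [key, MonoidHom.comp_apply, mk_eq_mk_of_rel h, ← MonoidHom.comp_apply]
  let P := PresentedMonoid (Rs n R₀)
  let g : Gen → P := PresentedMonoid.of (Rs n R₀)
  have rel : ∀ {u v}, Rs n R₀ u v → mk (Rs n R₀) u = mk (Rs n R₀) v := mk_eq_mk_of_rel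
  have mk_of : ∀ x, mk (Rs n R₀) (FreeMonoid.of x) = g x := fun _ => rfl
  let ε : P →* PT (Fin n) := lift (val n) (val_respects_Rs hn h₀)
  have hε : ∀ x, ε (g x) = val n x := fun x => lift_of _ _
  let ι₀ : PresentedMonoid R₀ →* P := lift (fun x => g x.toGen) (by
    have key : FreeMonoid.lift (fun x : Gen₀ => g x.toGen) =
        (mk (Rs n R₀)).comp (FreeMonoid.map Gen₀.toGen) := FreeMonoid.hom_eq fun x => by simp; rfl
    intro u v h
    rw [key]
    exact rel (.base u v h))
  have hι₀ : ∀ x, ι₀ (PresentedMonoid.of R₀ x) = g x.toGen := fun x => lift_of _ _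
  -- The presentation by `R₀` lifts `PTZeta n` into `P`, so identities between its transformations
  -- hold in `P` without rewriting words.
  let ι : PTZeta n →* P := ι₀.comp φ.symm.toMonoidHom
  have hι_gen : ∀ x, ι ⟨val₀ n x, val₀_mem_PTZeta hn x⟩ = g x.toGen := by
    intro x
    rw [← hι₀, show (⟨val₀ n x, val₀_mem_PTZeta hn x⟩ : PTZeta n) = φ (PresentedMonoid.of R₀ x)
      from Subtype.ext (hφ x).symm]
    exact congrArg ι₀ (φ.symm_apply_apply _)
  have hι : ∀ w, ε (ι w) = w := by
    have key : ε.comp ι₀ = (PTZeta n).subtype.comp φ.toMonoidHom := by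
      ext1 x
      rw [MonoidHom.comp_apply, hι₀, hε, val_toGen]
      exact (hφ x).symm
    intro w
    refine (DFunLike.congr_fun key (φ.symm w)).trans ?_
    exact congrArg Subtype.val (φ.apply_symm_apply w)
  have hb₀ : g .b₀ = ι ⟨val₀ n .b₀, val₀_mem_PTZeta hn .b₀⟩ := (hι_gen .b₀).symm
  have he₀ : g .e₀ = ι ⟨val₀ n .e₀, val₀_mem_PTZeta hn .e₀⟩ := (hι_gen .e₀).symm
  have hf₀ : g .f₀ = ι ⟨val₀ n .f₀, val₀_mem_PTZeta hn .f₀⟩ := (hι_gen .f₀).symm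
  have hω : ι (isolateZeta n) = (g .f₀ * g .b₀) ^ (n - 1) := by
    rw [hf₀, hb₀, ← map_mul, ← map_pow]
    exact congrArg ι (Subtype.ext (pow_f_b hn).symm)
  have hκ : ι (collapseZeta hn) = (g .e₀ * g .b₀) ^ (n - 3) * g .e₀ := by
    rw [he₀, hb₀, ← map_mul, ← map_pow, ← map_mul]
    exact congrArg ι (Subtype.ext (pow_e_b hn).symm)
  have hb : g .b₀ * g .z = g .z := rel .b_z
  have he : g .e₀ * g .z = g .z := rel .e_z
  have hrel : StarRelations hn ι (g .d) (g .z) :=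
    { d_sq := by simpa [pow_two, mk_of] using rel .d_sq
      comm := by
        have key : ∀ x, Commute (ι₀ x) (g .d) := by
          intro x
          have hx : x ∈ Submonoid.closure (Set.range (PresentedMonoid.of R₀)) := by simp
          induction hx using Submonoid.closure_induction with
          | mem x hx =>
            obtain ⟨y, rfl⟩ := hx
            rw [hι₀]
            cases y
            · exact rel .a_d
            · exact rel .b_d
            · exact rel .e_d
            · exact rel .f_d
          | one => rw [map_one]; exact Commute.one_left _
          | mul x y _ _ hx hy => rw [map_mul]; exact hx.mul_left hy
        exact fun w => key _
      collapse_z := by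
        have key : ∀ k, (g .e₀ * g .b₀) ^ k * g .z = g .z := by
          intro k
          induction k with
          | zero => simp
          | succ k ih => rw [pow_succ, mul_assoc, mul_assoc, hb, he, ih]
        rw [hκ, mul_assoc, he, key]
      z_sq := by
        rw [hκ]
        simpa [pow_two, mk_of] using rel .z_sq
      d_z := by
        refine Eq.trans ?_ (congrArg (g .z * ·) hf₀)
        exact rel .d_z
      z_d := by
        rw [hω]
        simpa [mk_of] using rel .z_d
      d_isolate_z := by
        rw [hω]
        simpa [mk_of] using rel .d_f_b_z }
  have hnormal : ∀ x, StarRelations.IsNormal ι (g .d) (g .z) x := by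
    intro x
    -- Words are built by prepending letters, matching the left multiplication lemmas.
    have hx : x ∈ Submonoid.closure (Set.range (PresentedMonoid.of (Rs n R₀))) := by simp
    induction hx using Submonoid.closure_induction_left with
    | one => exact Or.inl ⟨1, (map_one ι).symm⟩
    | mul_left y hy x _ ih =>
      obtain ⟨c, rfl⟩ := hy
      have ih₀ : ∀ c : Gen₀, StarRelations.IsNormal ι (g .d) (g .z) (g c.toGen * x) := fun c => by
        rw [← hι_gen c]
        exact StarRelations.isNormal_ι_mul ih _
      cases c
      · exact ih₀ .a₀
      · exact ih₀ .b₀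
      · exact ih₀ .e₀
      · exact ih₀ .f₀
      · exact hrel.isNormal_d_mul ih
      · exact hrel.isNormal_z_mul ih
  have hmem : ∀ x, ε x ∈ PsEnd (S n) := by
    intro x
    have hx : x ∈ Submonoid.closure (Set.range (PresentedMonoid.of (Rs n R₀))) := by simp
    induction hx using Submonoid.closure_induction with
    | mem x hx =>
      obtain ⟨c, rfl⟩ := hx
      exact (hε c).symm ▸ val_mem_PsEnd hn c
    | one => rw [map_one]; exact one_mem _
    | mul x y _ _ hx hy => rw [map_mul]; exact mul_mem hx hy
  refine ⟨MulEquiv.ofBijective (ε.codRestrict _ hmem) ⟨fun x y hxy => ?_, fun α => ?_⟩,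
    fun x => hε x⟩
  · exact hrel.eq_of_isNormal hι (hε .d) (hε .z) (hnormal x) (hnormal y)
      (congrArg Subtype.val hxy)
  · obtain ⟨x, hx⟩ := StarRelations.exists_eq_of_mem_PsEnd hn hι (hε .d) (hε .z) α.2
    exact ⟨x, Subtype.ext hx⟩

end Star

end StarMonoid

theorem theorem3p4 (n : ℕ) [NeZero n] (hn : 3 ≤ n)
    (R₀ : FreeMonoid StarMonoid.Gen₀ → FreeMonoid StarMonoid.Gen₀ → Prop)
    (hR₀ : StarMonoid.Defines R₀ (StarMonoid.val₀ n) (StarMonoid.PTZeta n)) :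
    StarMonoid.Defines (StarMonoid.Rs n R₀) (StarMonoid.val n)
        (StarMonoid.PsEnd (StarMonoid.S n)) ∧
      Nat.card (StarMonoid.PsEnd (StarMonoid.S n)) = 2 * n ^ (n - 1) + n * 2 ^ (n - 1) - 1 :=
  ⟨StarMonoid.defines_Rs hn hR₀, StarMonoid.card_PsEnd_star⟩
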